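/- Let $k$ be a field of characteristic $p>0$ and let $X$ be a variety over $k$ (an integral, separated scheme of finite type over $k$) such that $k$ is algebraically closed in the function field $K(X)$. Write $k^{1/p}$ for the field of $p$-th roots of the elements of $k$ (in a fixed algebraic closure of $k$), $Y_{\mathrm{red}}$ for the reduction of a scheme $Y$, and $Y^N$ for the normalisation of an integral scheme $Y$. For an intermediate field $k\subset l\subset k^{1/p}$ consider the condition $(\ast)$ $X\times_k l$ is an integral scheme, and the algebraic closure of $l$ in $K(X\times_k l)$ is equal to $k^{1/p}$ (that is, it is the image of an embedding of $k^{1/p}$ into $K(X\times_k l)$ over $l$; such an embedding is unique if it exists). Recall that, for field extensions $k\subset l\subset k'$ and a morphism of schemes $\varphi\colon X'\to X$, where $X'$ comes with a structure morphism to $\operatorname{Spec} k'$ compatible with $\varphi$, the pair $(k\subset l\subset k',\varphi)$ is an *elemental extension* of $(k,X)$ if $k\subset l$ is purely inseparable with $l^p\subset k$, $X\times_k l$ is integral, the induced morphism $X'\to X\times_k l$ is the normalisation of $X\times_k l$, $\varphi$ is its composite with the projection to $X$, and $k'$ is the algebraic closure of $l$ in $K(X')$. Then the following hold. 1. There exists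 an intermediate field $k\subset l\subset k^{1/p}$ satisfying $(\ast)$. Moreover, for every $l$ satisfying $(\ast)$, if $X':=((X\times_k k^{1/p})_{\mathrm{red}})^N$ and $\varphi\colon X'\to X$ is the induced morphism, then $(k\subset l\subset k^{1/p},\varphi\colon X'\to X)$ is an elemental extension of $(k,X)$ (with the induced structure morphism $X'\to\operatorname{Spec}k^{1/p}$). 2. For every intermediate field $k\subset l\subset k^{1/p}$ satisfying $(\ast)$, $X$ is geometrically reduced over $k$ if and only if $l=k^{1/p}$. -/

import Mathlib

open CategoryTheory CategoryTheory.Limits AlgebraicGeometry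

universe u

namespace Elemental

noncomputable section

/-! ### Base change along a field extension -/

/-- The morphism `Spec E ⟶ Spec F` of an extension of fields (more generally an algebra) `E / F`. -/
abbrev specMap (F E : Type u) [Field F] [Field E] [Algebra F E] :
    Spec (.of E) ⟶ Spec (.of F) :=
  Spec.map (CommRingCat.ofHom (algebraMap F E))

/-- The base change `X ×_k E` of a `k`-scheme `f : X ⟶ Spec k` to an extension field `E` of `k`. -/
abbrev baseChange {k : Type u} [Field k] {X : Scheme.{u}} (f : X ⟶ Spec (.of k))
    (E : Type u) [Field E] [Algebra k E] : Scheme.{u} :=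
  pullback f (specMap k E)

lemma irreducibleSpace_of_homeomorph {S T : Type*} [TopologicalSpace S] [TopologicalSpace T]
    [IrreducibleSpace S] (e : S ≃ₜ T) : IrreducibleSpace T := by
  rw [irreducibleSpace_def]
  simpa using (IrreducibleSpace.isIrreducible_univ S).image e e.continuous.continuousOn

lemma universallyInjective_specMap (k E : Type u) [Field k] [Field E] [Algebra k E]
    [IsPurelyInseparable k E] : UniversallyInjective (specMap k E) := by
  refine ((tfae_universallyInjective (specMap k E)).out 0 1 rfl rfl).mpr ?_
  intro K _ g₁ g₂ h
  obtain ⟨a, rfl⟩ := Spec.map_surjective g₁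
  obtain ⟨b, rfl⟩ := Spec.map_surjective g₂
  simp only [specMap, ← Spec.map_comp] at h
  have h' := congrArg CommRingCat.Hom.hom (Spec.map_injective h)
  simp only [CommRingCat.hom_comp, CommRingCat.hom_ofHom] at h'
  congr 1
  exact CommRingCat.hom_ext (IsPurelyInseparable.injective_comp_algebraMap k E _ h')

/-- A purely inseparable base change of an irreducible scheme is irreducible. -/
instance irreducibleSpace_baseChange {k : Type u} [Field k] {X : Scheme.{u}} [IrreducibleSpace X]
    (f : X ⟶ Spec (.of k)) (E : Type u) [Field E] [Algebra k E] [IsPurelyInseparable k E] :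
    IrreducibleSpace (baseChange f E) := by
  have h1 : UniversallyInjective (specMap k E) := universallyInjective_specMap k E
  have h2 : IsIntegralHom (specMap k E) := by
    rw [IsIntegralHom.SpecMap_iff]
    exact (inferInstance : Algebra.IsIntegral k E).isIntegral
  have h3 : Surjective (specMap k E) := by
    refine ⟨fun y => ⟨IsLocalRing.closedPoint E, Subsingleton.elim _ _⟩⟩
  have h4 : UniversallyInjective (pullback.fst f (specMap k E)) :=
    (UniversallyInjective.isStableUnderBaseChange).of_isPullback
      (IsPullback.of_hasPullback f (specMap k E)).flip h1
  have h5 : IsHomeomorph (pullback.fst f (specMap k E)) :=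
    isHomeomorph_iff_continuous_isClosedMap_bijective.mpr
      ⟨Scheme.Hom.continuous _, Scheme.Hom.isClosedMap _, Scheme.Hom.injective _,
        Scheme.Hom.surjective _⟩
  exact irreducibleSpace_of_homeomorph (h5.homeomorph _).symm

/-! ### Reduction and normalisation -/

/-- The reduced closed subscheme `Y_red` of `Y` with the same underlying space. -/
abbrev red (Y : Scheme.{u}) : Scheme.{u} := Y.nilradical.subscheme

/-- The closed immersion `Y_red ⟶ Y`. -/
abbrev redι (Y : Scheme.{u}) : red Y ⟶ Y := Y.nilradical.subschemeι

instance isReduced_red (Y : Scheme.{u}) : IsReduced (red Y) := by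
  have (U : Y.nilradical.subschemeCover.openCover.I₀) :
      IsReduced (Y.nilradical.subschemeCover.openCover.X U) := by
    have : _root_.IsReduced (Y.nilradical.subschemeCover.X U) := by
      let V : Y.affineOpens := U
      change _root_.IsReduced (Γ(Y, V.1) ⧸ Y.nilradical.ideal V)
      rw [← Ideal.isRadical_iff_quotient_reduced]
      exact Ideal.radical_isRadical _
    change IsReduced (Spec _)
    infer_instance
  exact IsReduced.of_openCover _ Y.nilradical.subschemeCover.openCover

instance isIntegral_red (Y : Scheme.{u}) [IrreducibleSpace Y] : IsIntegral (red Y) := by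
  have h : IsHomeomorph (redι Y) := by
    refine isHomeomorph_iff_isEmbedding_surjective.mpr ⟨(redι Y).isEmbedding, ?_⟩
    rw [← Set.range_eq_univ, Scheme.IdealSheafData.range_subschemeι, Scheme.support_nilradical]
    rfl
  have : IrreducibleSpace (red Y) := irreducibleSpace_of_homeomorph (h.homeomorph _).symm
  exact isIntegral_of_irreducibleSpace_of_isReduced _

/-- The canonical morphism `Spec K(Y) ⟶ Y` of an integral scheme `Y`. -/
abbrev fromSpecFunctionField (Y : Scheme.{u}) [IsIntegral Y] : Spec Y.functionField ⟶ Y :=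
  Y.fromSpecStalk (genericPoint Y)

instance quasiCompact_fromSpecFunctionField (Y : Scheme.{u}) [IsIntegral Y] :
    QuasiCompact (fromSpecFunctionField Y) := by
  have : Subsingleton (Spec Y.functionField) :=
    inferInstanceAs (Subsingleton (PrimeSpectrum Y.functionField))
  exact ⟨fun U _ _ => (Set.subsingleton_of_subsingleton).isCompact⟩

/-- The normalisation `Y^N` of an integral scheme `Y`: the relative normalisation of `Y` in the
spectrum of its function field. -/
abbrev normalisation (Y : Scheme.{u}) [IsIntegral Y] : Scheme.{u} :=
  (fromSpecFunctionField Y).normalization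

/-- The canonical morphism `Y^N ⟶ Y`. -/
abbrev fromNormalisation (Y : Scheme.{u}) [IsIntegral Y] : normalisation Y ⟶ Y :=
  (fromSpecFunctionField Y).fromNormalization

/-- The morphism `ν : Z ⟶ Y` is the normalisation of the integral scheme `Y`
(up to a unique isomorphism over `Y`). -/
def IsNormalisation {Z Y : Scheme.{u}} [IsIntegral Y] (ν : Z ⟶ Y) : Prop :=
  ∃ e : Z ≅ normalisation Y, e.hom ≫ fromNormalisation Y = ν

/-- The reduced normalisation `Y_red^N` of an irreducible scheme `Y`. -/
abbrev reducedNormalisation (Y : Scheme.{u}) [IrreducibleSpace Y] : Scheme.{u} :=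
  normalisation (red Y)

/-- The canonical morphism `Y_red^N ⟶ Y`. -/
abbrev fromReducedNormalisation (Y : Scheme.{u}) [IrreducibleSpace Y] :
    reducedNormalisation Y ⟶ Y :=
  fromNormalisation (red Y) ≫ redι Y

/-! ### Algebraic closure in the function field -/

/-- The field embedding `F ⟶ K(X)` induced by `f : X ⟶ Spec F`. -/
def toFunctionField {F : Type u} [Field F] {X : Scheme.{u}} [IsIntegral X]
    (f : X ⟶ Spec (.of F)) : F →+* X.functionField :=
  ((Scheme.ΓSpecIso (.of F)).inv ≫ f.appTop ≫ X.presheaf.germ ⊤ (genericPoint X) trivial).hom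

/-- For homomorphisms `φ : F → K` and `ι : E → K`, the image of
`ι` is the algebraic closure of `F` in `K`, that is, the set of all elements of `K` that are
algebraic over `F`. -/
def IsAlgClosureIn {F E K : Type u} [Field F] [Field E] [CommRing K]
    (φ : F →+* K) (ι : E →+* K) : Prop :=
  ∀ x : K, x ∈ ι.range ↔ letI := φ.toAlgebra; IsAlgebraic F x

/-- For an integral `k`-scheme `f : X ⟶ Spec k`: the field `k` is algebraically closed in `K(X)`. -/
def IsAlgClosedInFunctionField {k : Type u} [Field k] {X : Scheme.{u}} [IsIntegral X]
    (f : X ⟶ Spec (.of k)) : Prop :=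
  IsAlgClosureIn (toFunctionField f) (toFunctionField f)

/-! ### The field `k^{1/p}` -/

/-- The field `k^{1/p}`, inside an algebraic closure of `k`. -/
def rootField (k : Type u) [Field k] (p : ℕ) [Fact p.Prime] [CharP k p] :
    IntermediateField k (AlgebraicClosure k) where
  carrier := {x | ∃ a : k, algebraMap k (AlgebraicClosure k) a = x ^ p}
  mul_mem' := by
    rintro x y ⟨a, ha⟩ ⟨b, hb⟩
    exact ⟨a * b, by rw [map_mul, ha, hb, mul_pow]⟩
  add_mem' := by
    rintro x y ⟨a, ha⟩ ⟨b, hb⟩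
    have : CharP (AlgebraicClosure k) p := charP_of_injective_algebraMap
      (algebraMap k (AlgebraicClosure k)).injective p
    exact ⟨a + b, by rw [map_add, ha, hb, add_pow_char]⟩
  algebraMap_mem' a := ⟨a ^ p, map_pow _ _ _⟩
  inv_mem' := by
    rintro x ⟨a, ha⟩
    exact ⟨a⁻¹, by rw [map_inv₀, ha, inv_pow]⟩

instance isPurelyInseparable_rootField (k : Type u) [Field k] (p : ℕ) [Fact p.Prime] [CharP k p] :
    IsPurelyInseparable k (rootField k p) := by
  have : ExpChar k p := .prime (Fact.out)
  rw [isPurelyInseparable_iff_pow_mem k p]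
  rintro ⟨x, a, ha⟩
  exact ⟨1, a, Subtype.ext (by simpa using ha)⟩

/-! ### Elemental extensions -/

/-- Let `f : X ⟶ Spec k` be an integral scheme over a field `k` of characteristic `p > 0`, and let
`k ⊆ l ⊆ k'` be field extensions. The commutative diagram given by `φ : X' ⟶ X` and
`α' : X' ⟶ Spec k'` is an elemental extension of `(k, X)`. -/
structure IsElementalExtension (p : ℕ) {k l k' : Type u} [Field k] [Field l] [Field k']
    [Algebra k l] [Algebra l k'] [Algebra k k'] [IsScalarTower k l k']
    {X X' : Scheme.{u}} (f : X ⟶ Spec (.of k)) (φ : X' ⟶ X) (α' : X' ⟶ Spec (.of k')) :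
    Prop where
  isPurelyInseparable : IsPurelyInseparable k l
  pow_mem : ∀ x : l, x ^ p ∈ (algebraMap k l).range
  isIntegral_baseChange : IsIntegral (baseChange f l)
  /-- The structure morphisms of `X` and `X'` are compatible. -/
  comm : φ ≫ f = (α' ≫ specMap l k') ≫ specMap k l
  /-- The morphism `X' ⟶ X ×_k l` induced by `φ` is the normalisation; thus `φ` is the composite of
  the normalisation and the projection `X ×_k l ⟶ X`. -/
  isNormalisation : IsNormalisation
    (pullback.lift φ (α' ≫ specMap l k') comm : X' ⟶ baseChange f l)
  isIntegral : IsIntegral X'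
  /-- `k'` is the algebraic closure of `l` in `K(X')`. -/
  isAlgClosureIn : IsAlgClosureIn (toFunctionField (α' ≫ specMap l k')) (toFunctionField α')

/-- For an intermediate field `k ⊆ l ⊆ k^{1/p}`: the scheme `X ×_k l` is integral, and the algebraic
closure of `l` in `K(X ×_k l)` is equal to `k^{1/p}`, by way of an embedding of `k^{1/p}` in
`K(X ×_k l)` over `l` (there is at most one). -/
def IsRootClosure {k : Type u} [Field k] (p : ℕ) [Fact p.Prime] [CharP k p]
    {X : Scheme.{u}} (f : X ⟶ Spec (.of k)) (l : IntermediateField k (rootField k p)) : Prop :=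
  ∃ _ : IsIntegral (baseChange f l),
    ∃ ι : rootField k p →+* (baseChange f l).functionField,
      ι.comp (algebraMap l (rootField k p)) = toFunctionField (pullback.snd f (specMap k l)) ∧
      IsAlgClosureIn (toFunctionField (pullback.snd f (specMap k l))) ι

end

end Elemental

/-!
Write `K = K(X)` and choose `l ⊆ k^{1/p}` maximal such that `K ⊗ l` is reduced. The `p`-th power of
every element of `K ⊗ l` lies in `K`, so `K ⊗ l` is a field, namely `K(X ×_k l)`. If some `c ∈ k`
had no `p`-th root in it, then `t ^ p - c` would be irreducible over it and `l` could be enlarged by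
a root. Hence `k^{1/p}` embeds in `K(X ×_k l)`, and it is algebraically closed there: the `p`-th
power of an algebraic element is algebraic and lies in `K`, hence lies in `k`.

For any `l` as in `(∗)`, the function field of `Y = (X ×_k k^{1/p})_red` is generated by `K` and
`k^{1/p}`, both of which come from `K(X ×_k l)`. So `Y ⟶ X ×_k l` is integral and birational, and
the two schemes have the same normalisation. If `X` is geometrically reduced, then `K ⊗ k^{1/p}` is
a field, so its map to `K(X ×_k l)` is injective; as `K ⊗ l` already surjects, `l = k^{1/p}`. The
converse is Mac Lane's criterion.
-/

namespace Elemental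

open scoped TensorProduct

section HeightOne

open scoped IntermediateField

variable {k K E : Type*} [Field k] [Field K] [Field E] [Algebra k K] [Algebra k E] {p : ℕ}

lemma charP_tensorProduct (A B : Type*) [CommRing A] [CommRing B] [Nontrivial A] [Nontrivial B]
    [Algebra k A] [Algebra k B] [CharP k p] : CharP (A ⊗[k] B) p :=
  charP_of_injective_algebraMap (algebraMap k (A ⊗[k] B)).injective p

lemma nonempty_algHom_of_forall_exists_pow_eq {R : Type*} [CommRing R] [Algebra k R]
    [ExpChar E p] [ExpChar R p] [IsReduced R]
    (h : ∀ x : E, ∃ c : k, algebraMap k E c = x ^ p ∧ ∃ t : R, t ^ p = algebraMap k R c) :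
    Nonempty (E →ₐ[k] R) := by
  choose c hc σ hσ using h
  have hc_eq {x : E} {a : k} (ha : algebraMap k E a = x ^ p) : c x = a :=
    (algebraMap k E).injective ((hc x).trans ha.symm)
  have hσ_eq {x : E} {t : R} (ht : t ^ p = algebraMap k R (c x)) : σ x = t :=
    frobenius_inj R p ((hσ x).trans ht.symm)
  exact ⟨{
    toFun := σ
    map_zero' := hσ_eq (by rw [hc_eq (a := 0) (by simp [(expChar_pos E p).ne']), map_zero,
      zero_pow (expChar_pos E p).ne'])
    map_one' := hσ_eq (by rw [hc_eq (a := 1) (by simp), map_one, one_pow])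
    map_mul' x y := hσ_eq (by
      rw [hc_eq (a := c x * c y) (by rw [map_mul, hc, hc, mul_pow]), map_mul, mul_pow, hσ, hσ])
    map_add' x y := hσ_eq (by
      rw [hc_eq (a := c x + c y) (by rw [map_add, hc, hc, add_pow_expChar]), map_add,
        add_pow_expChar, hσ, hσ])
    commutes' a := hσ_eq (by rw [hc_eq (a := a ^ p) (map_pow _ _ _), map_pow]) }⟩

lemma isField_tensorProduct_adjoin_simple {l : Type*} [Field l] [Algebra k l] [Algebra l E]
    [IsScalarTower k l E] {a : E} (ha : IsIntegral l a) (hl : IsField (K ⊗[k] l))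
    (hirr : Irreducible ((minpoly l a).map
      (Algebra.TensorProduct.includeRight : l →ₐ[k] K ⊗[k] l).toRingHom)) :
    IsField (K ⊗[k] l⟮a⟯) := by
  let := hl.toField
  have := Fact.mk hirr
  let e : K ⊗[k] l⟮a⟯ ≃ₐ[k] K ⊗[k] AdjoinRoot (minpoly l a) :=
    Algebra.TensorProduct.congr .refl
      ((IntermediateField.adjoinRootEquivAdjoin l ha).symm.restrictScalars k)
  exact (e.toMulEquiv.trans
    (AdjoinRoot.tensorAlgEquiv (T := K) (minpoly l a) _ rfl).toMulEquiv).isField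
    (Field.toIsField (AdjoinRoot ((minpoly l a).map _)))

lemma isReduced_tensorProduct_sSup {A : Type*} [CommRing A] [Algebra k A]
    {C : Set (IntermediateField k E)} (hC : DirectedOn (· ≤ ·) C) (hne : C.Nonempty)
    (h : ∀ m ∈ C, IsReduced (A ⊗[k] m)) : IsReduced (A ⊗[k] (sSup C : IntermediateField k E)) := by
  classical
  refine IsReduced.tensorProduct_of_flat_of_forall_fg fun B hB => ?_
  obtain ⟨s, hs⟩ := hB.map (sSup C).val
  have hsC : IntermediateField.adjoin k (s : Set E) ≤ sSup C := by
    rw [IntermediateField.adjoin_le_iff]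
    intro x hx
    obtain ⟨y, -, rfl⟩ := (hs.le (Algebra.subset_adjoin hx) : x ∈ B.map (sSup C).val)
    exact y.2
  obtain ⟨m, hmC, hsm⟩ := (CompleteLattice.isCompactElement_iff_le_of_directed_sSup_le _ _).mp
    (IntermediateField.adjoin_finset_isCompactElement s) C hne hC hsC
  have hBm (b : B) : ((b : (sSup C : IntermediateField k E)) : E) ∈ m :=
    hsm ((IntermediateField.algebra_adjoin_le_adjoin k _) (hs.ge ⟨b, b.2, rfl⟩))
  let i : B →ₐ[k] m := ((sSup C).val.comp B.val).codRestrict m.toSubalgebra hBm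
  have hi : Function.Injective i := AlgHom.injective_codRestrict _ _ _ |>.mpr
    (Subtype.val_injective.comp Subtype.val_injective)
  have := h m hmC
  exact isReduced_of_injective (Algebra.TensorProduct.map (AlgHom.id A A) i)
    (Module.Flat.lTensor_preserves_injective_linearMap i.toLinearMap hi)

lemma exists_maximal_isReduced_tensorProduct (k K E : Type*) [Field k] [Field K] [Field E]
    [Algebra k K] [Algebra k E] :
    ∃ l : IntermediateField k E,
      Maximal (fun l : IntermediateField k E => IsReduced (K ⊗[k] l)) l := by
  have hbot : IsReduced (K ⊗[k] (⊥ : IntermediateField k E)) :=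
    isReduced_of_injective ((Algebra.TensorProduct.rid k k K).toAlgHom.comp
      (Algebra.TensorProduct.congr .refl (IntermediateField.botEquiv k E)).toAlgHom)
      ((Algebra.TensorProduct.rid k k K).injective.comp (AlgEquiv.injective _))
  obtain ⟨l, -, hl⟩ := zorn_le_nonempty₀ {l : IntermediateField k E | IsReduced (K ⊗[k] l)}
    (fun C hC hchain m hm => ⟨sSup C, isReduced_tensorProduct_sSup hchain.directedOn ⟨m, hm⟩ hC,
      fun z hz => le_sSup hz⟩) ⊥ hbot
  exact ⟨l, hl⟩

variable [Fact p.Prime]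

lemma isField_tensorProduct_adjoin_simple_of_pow_eq {l : Type*} [Field l] [Algebra k l]
    [Algebra l E] [IsScalarTower k l E] {x : E} {c : k} (hc : algebraMap k E c = x ^ p)
    (hl : IsField (K ⊗[k] l)) (hroot : ∀ t : K ⊗[k] l, t ^ p ≠ algebraMap k K c ⊗ₜ 1) :
    IsField (K ⊗[k] l⟮x⟯) := by
  have hp : p.Prime := Fact.out
  let P : Polynomial l := .X ^ p - .C (algebraMap k l c)
  have hmonic : P.Monic := Polynomial.monic_X_pow_sub_C _ hp.ne_zero
  have hPx : P.aeval x = 0 := by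
    simp [P, ← hc, ← IsScalarTower.algebraMap_apply]
  let j : l →ₐ[k] K ⊗[k] l := Algebra.TensorProduct.includeRight
  have hPj : Irreducible (P.map j.toRingHom) := by
    let := hl.toField
    have hP : P.map j.toRingHom = .X ^ p - .C (algebraMap k K c ⊗ₜ 1) := by
      simp [P, ← Algebra.TensorProduct.algebraMap_apply]
    rw [hP]
    exact X_pow_sub_C_irreducible_of_prime hp hroot
  have hmin : P = minpoly l x := by
    let := hl.toField
    exact minpoly.eq_of_irreducible_of_monic
      (hmonic.irreducible_of_irreducible_map j.toRingHom P hPj) hPx hmonic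
  exact isField_tensorProduct_adjoin_simple ⟨P, hmonic, hPx⟩ hl (hmin ▸ hPj)

lemma exists_pow_eq_of_maximal_isReduced_tensorProduct {l : IntermediateField k E}
    (hl : Maximal (fun l : IntermediateField k E => IsReduced (K ⊗[k] l)) l)
    (hlF : IsField (K ⊗[k] l)) {x : E} {c : k} (hc : algebraMap k E c = x ^ p) :
    ∃ t : K ⊗[k] l, t ^ p = algebraMap k K c ⊗ₜ 1 := by
  by_contra! hroot
  have hred : IsReduced (K ⊗[k] l⟮x⟯) :=
    let := (isField_tensorProduct_adjoin_simple_of_pow_eq hc hlF hroot).toField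
    inferInstance
  have hxl : x ∈ l := hl.le_of_ge (y := l⟮x⟯.restrictScalars k) hred
    (fun y hy => l⟮x⟯.algebraMap_mem ⟨y, hy⟩) (IntermediateField.mem_adjoin_simple_self l x)
  have hxc : (⟨x, hxl⟩ : l) ^ p = algebraMap k l c := Subtype.ext hc.symm
  refine hroot (1 ⊗ₜ ⟨x, hxl⟩) ?_
  rw [Algebra.TensorProduct.tmul_pow, one_pow, hxc, ← Algebra.TensorProduct.algebraMap_apply',
    Algebra.TensorProduct.algebraMap_apply]

variable [CharP k p]

lemma exists_pow_eq_tmul_one {A B : Type*} [CommRing A] [CommRing B] [Nontrivial A] [Nontrivial B]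
    [Algebra k A] [Algebra k B] (hB : ∀ b : B, b ^ p ∈ (algebraMap k B).range)
    (t : A ⊗[k] B) : ∃ a : A, t ^ p = a ⊗ₜ 1 := by
  have := charP_tensorProduct (k := k) (p := p) A B
  induction t with
  | zero => exact ⟨0, by simp [(Fact.out : p.Prime).ne_zero]⟩
  | tmul a b =>
    obtain ⟨c, hc⟩ := hB b
    exact ⟨c • a ^ p, by
      rw [Algebra.TensorProduct.tmul_pow, ← hc, Algebra.algebraMap_eq_smul_one,
        TensorProduct.tmul_smul, TensorProduct.smul_tmul']⟩
  | add x y hx hy =>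
    obtain ⟨a, ha⟩ := hx
    obtain ⟨b, hb⟩ := hy
    exact ⟨a + b, by rw [add_pow_char, ha, hb, TensorProduct.add_tmul]⟩

lemma isField_tensorProduct_of_isReduced (hE : ∀ x : E, x ^ p ∈ (algebraMap k E).range)
    [IsReduced (K ⊗[k] E)] : IsField (K ⊗[k] E) where
  exists_pair_ne := ⟨0, 1, zero_ne_one⟩
  mul_comm := mul_comm
  mul_inv_cancel {t} ht := by
    obtain ⟨a, ha⟩ := exists_pow_eq_tmul_one (A := K) hE t
    have ha0 : a ≠ 0 := by
      rintro rfl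
      exact ht (eq_zero_of_pow_eq_zero (ha.trans (TensorProduct.zero_tmul _ _)))
    refine ⟨t ^ (p - 1) * a⁻¹ ⊗ₜ 1, ?_⟩
    rw [← mul_assoc, mul_pow_sub_one (Fact.out : p.Prime).ne_zero, ha,
      Algebra.TensorProduct.tmul_mul_tmul, mul_inv_cancel₀ ha0, mul_one,
      Algebra.TensorProduct.one_def]

theorem exists_isReduced_tensorProduct_and_nonempty_algHom (K : Type*) [Field K] [Algebra k K]
    (hE : ∀ x : E, x ^ p ∈ (algebraMap k E).range) :
    ∃ l : IntermediateField k E, IsReduced (K ⊗[k] l) ∧ Nonempty (E →ₐ[k] K ⊗[k] l) := by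
  obtain ⟨l, hl⟩ := exists_maximal_isReduced_tensorProduct k K E
  have hlE (x : l) : x ^ p ∈ (algebraMap k l).range :=
    let ⟨c, hc⟩ := hE x
    ⟨c, Subtype.ext hc⟩
  have hred : IsReduced (K ⊗[k] l) := hl.prop
  have := charP_of_injective_algebraMap (algebraMap k E).injective p
  have := charP_tensorProduct (k := k) (p := p) K l
  refine ⟨l, hred, nonempty_algHom_of_forall_exists_pow_eq (p := p)
    (R := K ⊗[k] l) fun x => ?_⟩
  obtain ⟨c, hc⟩ := hE x
  exact ⟨c, hc, exists_pow_eq_of_maximal_isReduced_tensorProduct hl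
    (isField_tensorProduct_of_isReduced hlE) hc⟩

lemma eq_top_of_productMap_surjective {L : Type*} [CommRing L] [Nontrivial L] [Algebra k L]
    (hE : ∀ x : E, x ^ p ∈ (algebraMap k E).range) [IsReduced (K ⊗[k] E)]
    {l : IntermediateField k E} (φ : K →ₐ[k] L) (ι : E →ₐ[k] L)
    (h : Function.Surjective (Algebra.TensorProduct.productMap φ (ι.comp l.val))) : l = ⊤ := by
  have hinj : Function.Injective (Algebra.TensorProduct.productMap φ ι) :=
    have := isSimpleRing_iff_isField _ |>.mpr (isField_tensorProduct_of_isReduced (K := K) hE)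
    RingHom.injective (Algebra.TensorProduct.productMap φ ι).toRingHom
  have hcomp : Algebra.TensorProduct.productMap φ (ι.comp l.val) =
      (Algebra.TensorProduct.productMap φ ι).comp
        (Algebra.TensorProduct.map (AlgHom.id k K) l.val) := by
    ext <;> simp
  have hsurj : Function.Surjective (l.val.toLinearMap.lTensor K) := fun t => by
    obtain ⟨s, hs⟩ := h (Algebra.TensorProduct.productMap φ ι t)
    exact ⟨s, hinj (by rw [← hs, hcomp]; rfl)⟩
  rw [Module.FaithfullyFlat.lTensor_surjective_iff_surjective] at hsurj
  exact eq_top_iff.mpr fun x _ => let ⟨y, hy⟩ := hsurj x; hy ▸ y.2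

lemma range_productMap_eq_fieldRange_sup {L : Type*} [Field L] [Algebra k L]
    [Algebra.IsAlgebraic k E] (φ : K →ₐ[k] L) (ι : E →ₐ[k] L) :
    (Algebra.TensorProduct.productMap φ ι).range =
      (φ.fieldRange ⊔ ι.fieldRange).toSubalgebra := by
  have : Algebra.IsAlgebraic k ι.fieldRange :=
    (AlgEquiv.ofInjectiveField ι).isAlgebraic_iff.mp inferInstance
  rw [Algebra.TensorProduct.productMap_range,
    IntermediateField.sup_toSubalgebra_of_isAlgebraic_right, AlgHom.fieldRange_toSubalgebra,
    AlgHom.fieldRange_toSubalgebra]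

lemma productMap_surjective_of_surjectiveOnStalks {L : Type*} [Field L] [Algebra k L]
    [Algebra.IsAlgebraic k E] (φ : K →ₐ[k] L) (ι : E →ₐ[k] L)
    (h : (Algebra.TensorProduct.productMap φ ι).toRingHom.SurjectiveOnStalks) :
    Function.Surjective (Algebra.TensorProduct.productMap φ ι) := by
  intro y
  obtain ⟨a, b, c, hc, hb, hy⟩ :=
    RingHom.surjectiveOnStalks_iff_forall_ideal.mp h ⊥ bot_ne_top y
  have hmem (t : K ⊗[k] E) :
      Algebra.TensorProduct.productMap φ ι t ∈ φ.fieldRange ⊔ ι.fieldRange :=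
    (range_productMap_eq_fieldRange_sup φ ι).le ⟨t, rfl⟩
  have hy_div : y =
      Algebra.TensorProduct.productMap φ ι a / Algebra.TensorProduct.productMap φ ι b :=
    eq_div_of_mul_eq hb (mul_left_cancel₀ hc (by rw [mul_comm y, ← mul_assoc]; exact hy))
  have hy_mem : y ∈ φ.fieldRange ⊔ ι.fieldRange := hy_div ▸ div_mem (hmem a) (hmem b)
  exact (range_productMap_eq_fieldRange_sup φ ι).ge hy_mem

lemma mem_range_iff_isAlgebraic_of_forall_pow_mem_range {L : Type*} [Field L] [Algebra k L]
    [Algebra.IsAlgebraic k E] (hE : ∀ c : k, ∃ b : E, b ^ p = algebraMap k E c)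
    (hk : ∀ a : K, IsAlgebraic k a → a ∈ (algebraMap k K).range) (φ : K →ₐ[k] L)
    (hφ : ∀ y : L, ∃ a : K, φ a = y ^ p) (ι : E →ₐ[k] L) (y : L) :
    y ∈ ι.range ↔ IsAlgebraic k y := by
  constructor
  · rintro ⟨x, rfl⟩
    exact (Algebra.IsAlgebraic.isAlgebraic x).algHom ι
  · intro hy
    have := charP_of_injective_algebraMap (algebraMap k L).injective p
    obtain ⟨a, ha⟩ := hφ y
    obtain ⟨c, rfl⟩ := hk a ((isAlgebraic_algHom_iff φ φ.injective).mp (ha ▸ hy.pow p))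
    obtain ⟨b, hb⟩ := hE c
    refine ⟨b, frobenius_inj L p ?_⟩
    simpa [frobenius_def, ← map_pow, hb] using ha

section MacLane

variable {A : Type*} [CommRing A] [Algebra k A] {ι : Type*}

lemma linearIndependent_pow_of_isReduced_tensorProduct [IsReduced (E ⊗[k] A)] [Nontrivial A]
    (hE : ∀ c : k, ∃ b : E, b ^ p = algebraMap k E c) {v : ι → A} (hv : LinearIndependent k v) :
    LinearIndependent k fun i => v i ^ p := by
  have := charP_tensorProduct (k := k) (p := p) E A
  have hli : LinearIndependent E fun i => (1 : E) ⊗ₜ[k] v i :=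
    Module.Flat.linearIndependent_one_tmul hv
  rw [linearIndependent_iff']
  intro s c hc i hi
  choose b hb using hE
  have hpow : (∑ i ∈ s, b (c i) ⊗ₜ[k] v i) ^ p = 0 := by
    rw [sum_pow_char p]
    simp only [Algebra.TensorProduct.tmul_pow, hb, Algebra.algebraMap_eq_smul_one,
      TensorProduct.smul_tmul]
    rw [← TensorProduct.tmul_sum, hc, TensorProduct.tmul_zero]
  have hsum : ∑ i ∈ s, b (c i) • ((1 : E) ⊗ₜ[k] v i) = 0 := by
    simpa only [TensorProduct.smul_tmul', smul_eq_mul, mul_one] using eq_zero_of_pow_eq_zero hpow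
  have hbi : b (c i) = 0 :=
    linearIndependent_iff'.mp hli s (fun i => b (c i)) hsum i hi
  rw [← map_eq_zero (algebraMap k E), ← hb, hbi, zero_pow (Fact.out : p.Prime).ne_zero]

lemma isReduced_tensorProduct_of_linearIndependent_pow [Nontrivial A] (B : Module.Basis ι k A)
    (hB : LinearIndependent k fun i => B i ^ p) (S : Type*) [CommRing S] [Nontrivial S]
    [IsReduced S] [Algebra k S] : IsReduced (S ⊗[k] A) := by
  have := charP_tensorProduct (k := k) (p := p) S A
  have hli : LinearIndependent S fun i => (1 : S) ⊗ₜ[k] (B i ^ p) :=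
    Module.Flat.linearIndependent_one_tmul hB
  rw [isReduced_iff_pow_one_lt p (Fact.out : p.Prime).one_lt]
  intro t ht
  obtain ⟨c, rfl⟩ := (B.baseChange S).repr.symm.surjective t
  have hsum : ∑ i ∈ c.support, c i ^ p • (1 : S) ⊗ₜ[k] (B i ^ p) = 0 := by
    rw [← ht, Module.Basis.repr_symm_apply, Finsupp.linearCombination_apply, Finsupp.sum,
      sum_pow_char p]
    refine Finset.sum_congr rfl fun i _ => ?_
    rw [Module.Basis.baseChange_apply, smul_pow, Algebra.TensorProduct.tmul_pow, one_pow]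
  have hc : c = 0 := by
    ext i
    by_contra hi
    exact hi (eq_zero_of_pow_eq_zero
      (linearIndependent_iff'.mp hli _ _ hsum i (Finsupp.mem_support_iff.mpr hi)))
  rw [hc, map_zero]

theorem isReduced_tensorProduct_of_forall_exists_pow_eq [IsReduced (E ⊗[k] A)]
    (hE : ∀ c : k, ∃ b : E, b ^ p = algebraMap k E c) [Nontrivial A]
    (S : Type*) [CommRing S] [Nontrivial S] [IsReduced S] [Algebra k S] : IsReduced (S ⊗[k] A) :=
  let B := Module.Basis.ofVectorSpace k A
  isReduced_tensorProduct_of_linearIndependent_pow (p := p) B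
    (linearIndependent_pow_of_isReduced_tensorProduct hE B.linearIndependent) S

end MacLane

end HeightOne

section FunctionField

variable {X Y Z : Scheme.{u}} [IsIntegral X] [IsIntegral Y] [IsIntegral Z]

lemma apply_genericPoint_of_isDominant (g : Y ⟶ X) [IsDominant g] :
    g (genericPoint Y) = genericPoint X := by
  refine IsGenericPoint.eq ?_ (genericPoint_spec X)
  simpa only [Set.image_univ, g.denseRange.closure_eq] using
    (genericPoint_spec Y).image g.continuous

/-- The embedding of function fields `K(X) ⟶ K(Y)` induced by a dominant morphism `Y ⟶ X` of
integral schemes. -/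
noncomputable def functionFieldMap (g : Y ⟶ X) [IsDominant g] :
    X.functionField ⟶ Y.functionField :=
  X.presheaf.stalkSpecializes
    (Inseparable.of_eq (apply_genericPoint_of_isDominant g)).specializes ≫
      g.stalkMap (genericPoint Y)

lemma specMap_functionFieldMap_fromSpecFunctionField (g : Y ⟶ X) [IsDominant g] :
    Spec.map (functionFieldMap g) ≫ fromSpecFunctionField X = fromSpecFunctionField Y ≫ g := by
  simp [functionFieldMap]

lemma functionFieldMap_comp (h : Z ⟶ Y) (g : Y ⟶ X) [IsDominant h] [IsDominant g] :
    functionFieldMap (h ≫ g) = functionFieldMap g ≫ functionFieldMap h := by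
  apply Spec.map_injective
  rw [← cancel_mono (fromSpecFunctionField X), Spec.map_comp, Category.assoc]
  simp only [specMap_functionFieldMap_fromSpecFunctionField,
    reassoc_of% specMap_functionFieldMap_fromSpecFunctionField]

lemma functionFieldMap_surjective (g : Y ⟶ X) [IsDominant g] [IsPreimmersion g] :
    Function.Surjective (functionFieldMap g).hom := by
  have h := (Inseparable.of_eq (apply_genericPoint_of_isDominant g))
  have : IsIso (X.presheaf.stalkSpecializes h.specializes) := (X.presheaf.stalkCongr h).isIso_inv
  exact (g.stalkMap_surjective (genericPoint Y)).comp
    (ConcreteCategory.bijective_of_isIso (X.presheaf.stalkSpecializes h.specializes)).2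

lemma fromSpecFunctionField_comp {k : Type u} [Field k] (f : X ⟶ Spec (.of k)) :
    fromSpecFunctionField X ≫ f = Spec.map (CommRingCat.ofHom (toFunctionField f)) := by
  rw [toFunctionField, CommRingCat.ofHom_hom, Spec.map_comp, Spec.map_comp,
    ← Scheme.fromSpecStalk_toSpecΓ, Category.assoc, Category.assoc]
  erw [← Scheme.toSpecΓ_naturality_assoc]
  rw [← SpecMap_ΓSpecIso_hom, ← Spec.map_comp, Iso.inv_hom_id, Spec.map_id, Category.comp_id]

lemma toFunctionField_comp {k : Type u} [Field k] (f : X ⟶ Spec (.of k)) (g : Y ⟶ X)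
    [IsDominant g] :
    toFunctionField (g ≫ f) = (functionFieldMap g).hom.comp (toFunctionField f) := by
  have h : CommRingCat.ofHom (toFunctionField (g ≫ f)) =
      CommRingCat.ofHom (toFunctionField f) ≫ functionFieldMap g := by
    apply Spec.map_injective
    rw [Spec.map_comp, ← fromSpecFunctionField_comp, ← fromSpecFunctionField_comp,
      reassoc_of% specMap_functionFieldMap_fromSpecFunctionField]
  exact congrArg CommRingCat.Hom.hom h

lemma toFunctionField_comp_specMap {k l : Type u} [Field k] [Field l] [Algebra k l]
    (f : X ⟶ Spec (.of l)) :
    toFunctionField (f ≫ specMap k l) = (toFunctionField f).comp (algebraMap k l) := by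
  have h : CommRingCat.ofHom (toFunctionField (f ≫ specMap k l)) =
      CommRingCat.ofHom (algebraMap k l) ≫ CommRingCat.ofHom (toFunctionField f) := by
    apply Spec.map_injective
    rw [Spec.map_comp, ← fromSpecFunctionField_comp, ← fromSpecFunctionField_comp, Category.assoc]
  exact congrArg CommRingCat.Hom.hom h

instance isDominant_fromSpecFunctionField : IsDominant (fromSpecFunctionField X) := by
  refine ⟨dense_iff_closure_eq.mpr (Set.univ_subset_iff.mp ?_)⟩
  rw [← (genericPoint_spec X).def]
  exact closure_mono (Set.singleton_subset_iff.mpr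
    ⟨IsLocalRing.closedPoint _, Scheme.fromSpecStalk_closedPoint⟩)

end FunctionField

section Normalisation

variable {X Y : Scheme.{u}} [IsIntegral X] [IsIntegral Y]

instance isDominant_fromNormalisation : IsDominant (fromNormalisation Y) := by
  have : IsDominant ((fromSpecFunctionField Y).toNormalization ≫ fromNormalisation Y) := by
    rw [Scheme.Hom.toNormalization_fromNormalization]
    infer_instance
  exact .of_comp (fromSpecFunctionField Y).toNormalization _

lemma bijective_functionFieldMap_fromNormalisation :
    Function.Bijective (functionFieldMap (fromNormalisation Y)).hom := by
  let t := (fromSpecFunctionField Y).toNormalization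
  have : IsPreimmersion (t ≫ fromNormalisation Y) := by
    rw [Scheme.Hom.toNormalization_fromNormalization]
    infer_instance
  have hcomp := functionFieldMap_surjective (t ≫ fromNormalisation Y)
  rw [functionFieldMap_comp, CommRingCat.hom_comp, RingHom.coe_comp] at hcomp
  exact ⟨RingHom.injective _, .of_comp_left hcomp (RingHom.injective _)⟩

lemma isNormalisation_fromNormalisation_comp (g : Y ⟶ X) [IsDominant g] [IsIntegralHom g]
    (hg : Function.Bijective (functionFieldMap g).hom) :
    IsNormalisation (fromNormalisation Y ≫ g) := by
  let iX := fromSpecFunctionField X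
  let iY := fromSpecFunctionField Y
  have : IsIso (functionFieldMap g) := (ConcreteCategory.isIso_iff_bijective _).mpr hg
  let s := Spec.map (functionFieldMap g)
  have hs : s ≫ iX = iY ≫ g := specMap_functionFieldMap_fromSpecFunctionField g
  obtain ⟨a, hiY_a, ha⟩ : ∃ a : normalisation Y ⟶ normalisation X,
      iY.toNormalization ≫ a = s ≫ iX.toNormalization ∧
        a ≫ fromNormalisation X = fromNormalisation Y ≫ g := by
    let toPullback : Spec Y.functionField ⟶ pullback (fromNormalisation X) g :=
      pullback.lift (s ≫ iX.toNormalization) iY (by simp [hs, iX])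
    refine ⟨iY.normalizationDesc toPullback (pullback.snd _ _) (pullback.lift_snd _ _ _).symm ≫
      pullback.fst _ _, ?_, ?_⟩
    · rw [Scheme.Hom.toNormalization_normalizationDesc_assoc]
      exact pullback.lift_fst _ _ _
    · rw [Category.assoc, pullback.condition, Scheme.Hom.normalizationDesc_comp_assoc]
  obtain ⟨b, hiX_b, hb⟩ : ∃ b : normalisation X ⟶ normalisation Y,
      iX.toNormalization ≫ b = inv s ≫ iY.toNormalization ∧
        b ≫ fromNormalisation Y ≫ g = fromNormalisation X :=
    ⟨iX.normalizationDesc (inv s ≫ iY.toNormalization) (fromNormalisation Y ≫ g)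
      (by simp [← hs, iY]), by simp, Scheme.Hom.normalizationDesc_comp ..⟩
  refine ⟨⟨a, b, ?_, ?_⟩, ha⟩
  · exact ext_of_isDominant_of_isSeparated (fromNormalisation Y ≫ g) (by simp [hb, ha])
      iY.toNormalization (by simp [reassoc_of% hiY_a, hiX_b])
  · exact ext_of_isDominant_of_isSeparated (fromNormalisation X) (by simp [hb, ha])
      iX.toNormalization (by simp [reassoc_of% hiX_b, hiY_a])

end Normalisation

section GenericFibre

instance flat_fromSpecFunctionField (X : Scheme.{u}) [IsIntegral X] :
    Flat (fromSpecFunctionField X) := by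
  obtain ⟨_, ⟨U, hU, rfl⟩, hxU, -⟩ := X.isBasis_affineOpens.exists_subset_of_mem_open
    (Set.mem_univ (genericPoint X)) isOpen_univ
  have : Nonempty U := ⟨⟨_, hxU⟩⟩
  have := functionField_isFractionRing_of_isAffineOpen X U hU
  have hgerm : (X.presheaf.germ U _ hxU).hom.Flat :=
    IsLocalization.flat X.functionField (nonZeroDivisors Γ(X, U))
  have : Flat (Spec.map (X.presheaf.germ U _ hxU)) := Flat.SpecMap_iff.mpr hgerm
  have := hU.isOpenImmersion_fromSpec
  rw [fromSpecFunctionField, ← hU.fromSpecStalk_eq_fromSpecStalk hxU]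
  exact MorphismProperty.comp_mem @Flat _ hU.fromSpec ‹_› (inferInstanceAs (Flat _))

lemma isReduced_of_flat_of_isPreimmersion {X Y : Scheme.{u}} (g : Y ⟶ X) [Flat g]
    [IsPreimmersion g] [IsReduced X] : IsReduced Y := by
  have (y : Y) : _root_.IsReduced (Y.presheaf.stalk y) := by
    have hinj : Function.Injective (g.stalkMap y).hom := by
      algebraize [(g.stalkMap y).hom]
      have : Module.Flat (X.presheaf.stalk (g y)) (Y.presheaf.stalk y) := Flat.stalkMap g y
      have : IsLocalHom (algebraMap (X.presheaf.stalk (g y)) (Y.presheaf.stalk y)) :=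
        inferInstanceAs (IsLocalHom (g.stalkMap y).hom)
      have : Module.FaithfullyFlat (X.presheaf.stalk (g y)) (Y.presheaf.stalk y) :=
        Module.FaithfullyFlat.of_flat_of_isLocalHom
      exact FaithfulSMul.algebraMap_injective (X.presheaf.stalk (g y)) (Y.presheaf.stalk y)
    let e := RingEquiv.ofBijective (g.stalkMap y).hom ⟨hinj, g.stalkMap_surjective y⟩
    exact isReduced_of_injective e.symm.toRingHom e.symm.injective
  exact isReduced_of_isReduced_stalk _

section Fibre

variable {k : Type u} [Field k] {X : Scheme.{u}} {f : X ⟶ Spec (.of k)} (K E : Type u) [Field K]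
  [Field E] [Algebra k K] [Algebra k E] {η : Spec (.of K) ⟶ X} (hη : η ≫ f = specMap k K)

/-- The base change `Spec (K ⊗ E) ⟶ X ×_k E` of a `K`-valued point `η` of the `k`-scheme `X`,
through which properties of `X ×_k E` at the generic point become properties of `K(X) ⊗ E`. -/
noncomputable def fibreMap : Spec (.of (K ⊗[k] E)) ⟶ baseChange f E :=
  pullback.lift
    (Spec.map (CommRingCat.ofHom (Algebra.TensorProduct.includeLeftRingHom : K →+* K ⊗[k] E)) ≫ η)
    (Spec.map (CommRingCat.ofHom
      (Algebra.TensorProduct.includeRight : E →ₐ[k] K ⊗[k] E).toRingHom))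
    (by rw [Category.assoc, hη]
        exact (isPullback_SpecMap_of_isPushout _ _ _ _
          (CommRingCat.isPushout_tensorProduct k K E)).w)

lemma isPullback_fibreMap :
    IsPullback (fibreMap K E hη)
      (Spec.map (CommRingCat.ofHom (Algebra.TensorProduct.includeLeftRingHom : K →+* K ⊗[k] E)))
      (pullback.fst f (specMap k E)) η := by
  refine .of_right (h₁₂ := pullback.snd f (specMap k E)) (h₂₂ := f) ?_ (pullback.lift_fst _ _ _)
    (IsPullback.of_hasPullback f (specMap k E)).flip
  rw [fibreMap, pullback.lift_snd, hη]
  exact (isPullback_SpecMap_of_isPushout _ _ _ _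
    (CommRingCat.isPushout_tensorProduct k K E)).flip

instance isPreimmersion_fibreMap [IsPreimmersion η] : IsPreimmersion (fibreMap K E hη) :=
  MorphismProperty.of_isPullback (isPullback_fibreMap K E hη).flip ‹_›

end Fibre

variable {k : Type u} [Field k] {X Y : Scheme.{u}} [IsIntegral X] [IsIntegral Y]
  {f : X ⟶ Spec (.of k)} {E : Type u} [Field E] [Algebra k E] [Algebra k X.functionField]

lemma fromSpecFunctionField_comp_eq_specMap
    (hf : algebraMap k X.functionField = toFunctionField f) :
    fromSpecFunctionField X ≫ f = specMap k X.functionField := by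
  rw [fromSpecFunctionField_comp, ← hf]

lemma isReduced_baseChange_iff (hf : algebraMap k X.functionField = toFunctionField f) :
    IsReduced (baseChange f E) ↔ _root_.IsReduced (X.functionField ⊗[k] E) := by
  have hη := fromSpecFunctionField_comp_eq_specMap hf
  let v := fibreMap X.functionField E hη
  have hv := (isPullback_fibreMap X.functionField E hη).flip
  rw [← affine_isReduced_iff (.of (X.functionField ⊗[k] E))]
  constructor
  · intro hred
    have : Flat v := MorphismProperty.of_isPullback hv (flat_fromSpecFunctionField X)
    exact isReduced_of_flat_of_isPreimmersion v
  · intro hred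
    have : IsSchemeTheoreticallyDominant (fromSpecFunctionField X) := .of_isDominant _
    have : IsSchemeTheoreticallyDominant v := .of_isPullback hv
    have : QuasiCompact v :=
      MorphismProperty.of_isPullback hv (quasiCompact_fromSpecFunctionField X)
    exact IsSchemeTheoreticallyDominant.isReduced v

variable [Algebra k Y.functionField] [Algebra.IsAlgebraic k E]

lemma productMap_surjective_of_isPreimmersion
    (hf : algebraMap k X.functionField = toFunctionField f)
    (j : Y ⟶ baseChange f E) [IsPreimmersion j] {q : Y ⟶ X} [IsDominant q]
    (hq : j ≫ pullback.fst f (specMap k E) = q)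
    {φ : X.functionField →ₐ[k] Y.functionField} (hφ : φ.toRingHom = (functionFieldMap q).hom)
    {ι : E →ₐ[k] Y.functionField}
    (hι : ι.toRingHom = toFunctionField (j ≫ pullback.snd f (specMap k E))) :
    Function.Surjective (Algebra.TensorProduct.productMap φ ι) := by
  have hη := fromSpecFunctionField_comp_eq_specMap hf
  let P : CommRingCat.of (X.functionField ⊗[k] E) ⟶ Y.functionField :=
    CommRingCat.ofHom (Algebra.TensorProduct.productMap φ ι).toRingHom
  have hleft : CommRingCat.ofHom Algebra.TensorProduct.includeLeftRingHom ≫ P =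
      functionFieldMap q := by
    ext x
    exact (Algebra.TensorProduct.productMap_left_apply φ ι x).trans (DFunLike.congr_fun hφ x)
  have hright : CommRingCat.ofHom
      (Algebra.TensorProduct.includeRight : E →ₐ[k] X.functionField ⊗[k] E).toRingHom ≫ P =
      CommRingCat.ofHom (toFunctionField (j ≫ pullback.snd f (specMap k E))) := by
    ext x
    exact (Algebra.TensorProduct.productMap_right_apply φ ι x).trans (DFunLike.congr_fun hι x)
  have hfac : Spec.map P ≫ fibreMap X.functionField E hη =
      fromSpecFunctionField Y ≫ j := by
    apply pullback.hom_ext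
    · rw [fibreMap, Category.assoc, pullback.lift_fst, ← Spec.map_comp_assoc, hleft,
        specMap_functionFieldMap_fromSpecFunctionField, Category.assoc, hq]
    · rw [fibreMap, Category.assoc, pullback.lift_snd, ← Spec.map_comp, hright,
        ← fromSpecFunctionField_comp, Category.assoc]
  have : IsPreimmersion (fibreMap X.functionField E hη) :=
    isPreimmersion_fibreMap X.functionField E hη
  have : IsPreimmersion (Spec.map P ≫ fibreMap X.functionField E hη) := by
    rw [hfac]
    infer_instance
  have : IsPreimmersion (Spec.map P) := .of_comp _ (fibreMap X.functionField E hη)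
  exact productMap_surjective_of_surjectiveOnStalks φ ι ((IsPreimmersion.SpecMap_iff P).mp this).2

lemma exists_productMap_surjective (hX : algebraMap k X.functionField = toFunctionField f)
    (j : Y ⟶ baseChange f E) [IsPreimmersion j] {q : Y ⟶ X} [IsDominant q]
    (hq : j ≫ pullback.fst f (specMap k E) = q)
    (hY : algebraMap k Y.functionField = toFunctionField (q ≫ f)) :
    ∃ (φ : X.functionField →ₐ[k] Y.functionField) (ι : E →ₐ[k] Y.functionField),
      φ.toRingHom = (functionFieldMap q).hom ∧
        ι.toRingHom = toFunctionField (j ≫ pullback.snd f (specMap k E)) ∧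
          Function.Surjective (Algebra.TensorProduct.productMap φ ι) := by
  have hφ : (functionFieldMap q).hom.comp (algebraMap k X.functionField) =
      algebraMap k Y.functionField := by
    rw [hX, hY, toFunctionField_comp]
  have hι : (toFunctionField (j ≫ pullback.snd f (specMap k E))).comp (algebraMap k E) =
      algebraMap k Y.functionField := by
    rw [hY, ← toFunctionField_comp_specMap, Category.assoc, ← pullback.condition,
      reassoc_of% hq]
  exact ⟨⟨(functionFieldMap q).hom, DFunLike.congr_fun hφ⟩, ⟨_, DFunLike.congr_fun hι⟩, rfl, rfl,
    productMap_surjective_of_isPreimmersion hX j hq rfl rfl⟩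

end GenericFibre

instance surjective_specMap (F E : Type u) [Field F] [Field E] [Algebra F E] :
    Surjective (specMap F E) :=
  ⟨fun _ => ⟨IsLocalRing.closedPoint E, Subsingleton.elim _ _⟩⟩

instance surjective_redι (Y : Scheme.{u}) : Surjective (redι Y) := by
  refine ⟨?_⟩
  rw [← Set.range_eq_univ, Scheme.IdealSheafData.range_subschemeι, Scheme.support_nilradical]
  rfl

section Tower

variable {k : Type u} [Field k] {X : Scheme.{u}} (f : X ⟶ Spec (.of k)) (l E : Type u) [Field l]
  [Field E] [Algebra k l] [Algebra k E] [Algebra l E] [IsScalarTower k l E]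

lemma specMap_comp_specMap : specMap l E ≫ specMap k l = specMap k E := by
  rw [← Spec.map_comp, ← CommRingCat.ofHom_comp, ← IsScalarTower.algebraMap_eq]

/-- The morphism `X ×_k E ⟶ X ×_k l` of a tower of field extensions `E / l / k`. -/
noncomputable def baseChangeMap : baseChange f E ⟶ baseChange f l :=
  pullback.lift (pullback.fst f (specMap k E)) (pullback.snd f (specMap k E) ≫ specMap l E) (by
    rw [Category.assoc, specMap_comp_specMap, pullback.condition])

lemma baseChangeMap_fst :
    baseChangeMap f l E ≫ pullback.fst f (specMap k l) = pullback.fst f (specMap k E) :=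
  pullback.lift_fst _ _ _

lemma baseChangeMap_snd : baseChangeMap f l E ≫ pullback.snd f (specMap k l) =
    pullback.snd f (specMap k E) ≫ specMap l E :=
  pullback.lift_snd _ _ _

lemma isPullback_baseChangeMap : IsPullback (pullback.snd f (specMap k E)) (baseChangeMap f l E)
    (specMap l E) (pullback.snd f (specMap k l)) := by
  refine .of_bot (v₂₁ := pullback.fst f (specMap k l)) (h₃₁ := f) (v₂₂ := specMap k l) ?_
    (baseChangeMap_snd f l E).symm (IsPullback.of_hasPullback f (specMap k l)).flip
  rw [baseChangeMap_fst, specMap_comp_specMap]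
  exact (IsPullback.of_hasPullback f (specMap k E)).flip

instance surjective_baseChangeMap : Surjective (baseChangeMap f l E) :=
  MorphismProperty.of_isPullback (isPullback_baseChangeMap f l E) (surjective_specMap l E)

instance isIntegralHom_baseChangeMap [Algebra.IsAlgebraic l E] :
    IsIntegralHom (baseChangeMap f l E) :=
  MorphismProperty.of_isPullback (isPullback_baseChangeMap f l E)
    (IsIntegralHom.SpecMap_iff.mpr (algebraMap_isIntegral_iff.mpr inferInstance))

/-- The morphism `(X ×_k E)_red ⟶ X ×_k l` of a tower of field extensions `E / l / k`. -/
noncomputable abbrev redBaseChangeMap : red (baseChange f E) ⟶ baseChange f l :=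
  redι _ ≫ baseChangeMap f l E

lemma redBaseChangeMap_fst : redBaseChangeMap f l E ≫ pullback.fst f (specMap k l) =
    redι _ ≫ pullback.fst f (specMap k E) := by
  rw [Category.assoc, baseChangeMap_fst]

lemma redBaseChangeMap_snd : redBaseChangeMap f l E ≫ pullback.snd f (specMap k l) =
    (redι _ ≫ pullback.snd f (specMap k E)) ≫ specMap l E := by
  rw [Category.assoc, Category.assoc, baseChangeMap_snd]

end Tower

section AlgebraicClosure

lemma isAlgClosureIn_comp_algebraMap_iff {k l E K : Type u} [Field k] [Field l] [Field E]
    [CommRing K] [Algebra k l] [Algebra.IsAlgebraic k l] {φ : l →+* K} {ι : E →+* K} :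
    IsAlgClosureIn (φ.comp (algebraMap k l)) ι ↔ IsAlgClosureIn φ ι := by
  let := φ.toAlgebra
  let := (φ.comp (algebraMap k l)).toAlgebra
  have : IsScalarTower k l K := .of_algebraMap_eq' rfl
  exact forall_congr' fun x => iff_congr .rfl
    ⟨fun h => h.extendScalars (algebraMap k l).injective, fun h => h.restrictScalars k⟩

lemma isAlgClosureIn_comp_of_bijective {F E K L : Type u} [Field F] [Field E] [CommRing K]
    [CommRing L] {φ : F →+* K} {ι : E →+* K} (h : IsAlgClosureIn φ ι) {g : K →+* L}
    (hg : Function.Bijective g) : IsAlgClosureIn (g.comp φ) (g.comp ι) := by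
  let := φ.toAlgebra
  let := (g.comp φ).toAlgebra
  let gAlg : K →ₐ[F] L := ⟨g, fun _ => rfl⟩
  intro y
  obtain ⟨x, rfl⟩ := hg.2 y
  have hrange : g x ∈ (g.comp ι).range ↔ x ∈ ι.range :=
    exists_congr fun _ => hg.1.eq_iff
  exact hrange.trans ((h x).trans (isAlgebraic_algHom_iff gAlg hg.1).symm)

end AlgebraicClosure

section PurelyInseparable

variable {k : Type u} [Field k] {X : Scheme.{u}} {f : X ⟶ Spec (.of k)}
  {l E : Type u} [Field l] [Field E] [Algebra k l] [Algebra k E] [Algebra l E]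
  [IsScalarTower k l E] [IsPurelyInseparable k E] [IsIntegral (baseChange f l)]
  {ι : E →+* (baseChange f l).functionField}

lemma functionFieldMap_redBaseChangeMap_comp [IrreducibleSpace X]
    (hι : ι.comp (algebraMap l E) = toFunctionField (pullback.snd f (specMap k l))) :
    (functionFieldMap (redBaseChangeMap f l E)).hom.comp ι =
      toFunctionField (redι _ ≫ pullback.snd f (specMap k E)) := by
  have : IsPurelyInseparable l E := .tower_top k l E
  refine IsPurelyInseparable.injective_comp_algebraMap l E _ ?_
  change ((functionFieldMap (redBaseChangeMap f l E)).hom.comp ι).comp (algebraMap l E) =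
    (toFunctionField (redι _ ≫ pullback.snd f (specMap k E))).comp (algebraMap l E)
  rw [RingHom.comp_assoc, hι, ← toFunctionField_comp, ← toFunctionField_comp_specMap,
    redBaseChangeMap_snd]

lemma bijective_functionFieldMap_redBaseChangeMap [IsIntegral X]
    (hι : ι.comp (algebraMap l E) = toFunctionField (pullback.snd f (specMap k l))) :
    Function.Bijective (functionFieldMap (redBaseChangeMap f l E)).hom := by
  let Y := red (baseChange f E)
  let ψ := (functionFieldMap (redBaseChangeMap f l E)).hom
  let q := redBaseChangeMap f l E ≫ pullback.fst f (specMap k l)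
  let : Algebra k X.functionField := (toFunctionField f).toAlgebra
  let : Algebra k Y.functionField := (toFunctionField (q ≫ f)).toAlgebra
  obtain ⟨φ, κ, hφ, hκ, hsurj⟩ := exists_productMap_surjective (f := f) rfl (redι _)
    (q := q) (redBaseChangeMap_fst f l E).symm rfl
  have hφ_mem (x : X.functionField) : φ x ∈ ψ.fieldRange :=
    ⟨(functionFieldMap (pullback.fst f (specMap k l))).hom x, by
      rw [functionFieldMap_comp] at hφ
      exact (DFunLike.congr_fun hφ x).symm⟩
  have hκ_mem (x : E) : κ x ∈ ψ.fieldRange :=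
    ⟨ι x, DFunLike.congr_fun ((functionFieldMap_redBaseChangeMap_comp hι).trans hκ.symm) x⟩
  refine ⟨RingHom.injective _, fun y => ?_⟩
  obtain ⟨t, rfl⟩ := hsurj y
  change _ ∈ ψ.fieldRange
  induction t with
  | zero => exact map_zero (Algebra.TensorProduct.productMap φ κ) ▸ zero_mem _
  | add s t hs ht => exact map_add (Algebra.TensorProduct.productMap φ κ) s t ▸ add_mem hs ht
  | tmul a b => exact mul_mem (hφ_mem a) (hκ_mem b)

end PurelyInseparable

section ElementalExtension

variable {k : Type u} [Field k] {X : Scheme.{u}} {f : X ⟶ Spec (.of k)}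
  {l E : Type u} [Field l] [Field E] [Algebra k l] [Algebra k E] [Algebra l E]
  [IsScalarTower k l E] [IsPurelyInseparable k E]

lemma fromReducedNormalisation_fst_comp [IrreducibleSpace X] :
    (fromReducedNormalisation (baseChange f E) ≫ pullback.fst f (specMap k E)) ≫ f =
      ((fromReducedNormalisation (baseChange f E) ≫ pullback.snd f (specMap k E)) ≫
        specMap l E) ≫ specMap k l := by
  simp only [Category.assoc, specMap_comp_specMap, pullback.condition]

variable [IsIntegral X] [IsIntegral (baseChange f l)] {ι : E →+* (baseChange f l).functionField}

lemma isNormalisation_lift_fromReducedNormalisation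
    (hι : ι.comp (algebraMap l E) = toFunctionField (pullback.snd f (specMap k l))) :
    IsNormalisation (pullback.lift
      (fromReducedNormalisation (baseChange f E) ≫ pullback.fst f (specMap k E))
      ((fromReducedNormalisation (baseChange f E) ≫ pullback.snd f (specMap k E)) ≫ specMap l E)
      fromReducedNormalisation_fst_comp : _ ⟶ baseChange f l) := by
  have : IsPurelyInseparable l E := .tower_top k l E
  convert isNormalisation_fromNormalisation_comp (redBaseChangeMap f l E)
    (bijective_functionFieldMap_redBaseChangeMap hι)
  apply pullback.hom_ext
  · rw [pullback.lift_fst, Category.assoc, Category.assoc, redBaseChangeMap_fst]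
  · rw [pullback.lift_snd, Category.assoc _ (redBaseChangeMap f l E), redBaseChangeMap_snd]
    simp only [Category.assoc]

lemma isAlgClosureIn_toFunctionField_fromReducedNormalisation
    (hι : ι.comp (algebraMap l E) = toFunctionField (pullback.snd f (specMap k l)))
    (h : IsAlgClosureIn (toFunctionField (pullback.snd f (specMap k l))) ι) :
    IsAlgClosureIn
      (toFunctionField ((fromReducedNormalisation (baseChange f E) ≫
        pullback.snd f (specMap k E)) ≫ specMap l E))
      (toFunctionField (fromReducedNormalisation (baseChange f E) ≫
        pullback.snd f (specMap k E))) := by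
  have hred : IsAlgClosureIn
      (toFunctionField (redBaseChangeMap f l E ≫ pullback.snd f (specMap k l)))
      (toFunctionField (redι _ ≫ pullback.snd f (specMap k E))) := by
    rw [toFunctionField_comp, ← functionFieldMap_redBaseChangeMap_comp hι]
    exact isAlgClosureIn_comp_of_bijective h (bijective_functionFieldMap_redBaseChangeMap hι)
  have hnorm := isAlgClosureIn_comp_of_bijective hred
    (bijective_functionFieldMap_fromNormalisation (Y := red (baseChange f E)))
  rw [← toFunctionField_comp, ← toFunctionField_comp, redBaseChangeMap_snd] at hnorm
  simpa only [Category.assoc] using hnorm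

theorem isElementalExtension_of_isAlgClosureIn {p : ℕ}
    (hE : ∀ x : E, x ^ p ∈ (algebraMap k E).range)
    (hι : ι.comp (algebraMap l E) = toFunctionField (pullback.snd f (specMap k l)))
    (h : IsAlgClosureIn (toFunctionField (pullback.snd f (specMap k l))) ι) :
    IsElementalExtension p (k := k) (l := l) (k' := E) f
      (fromReducedNormalisation (baseChange f E) ≫ pullback.fst f (specMap k E))
      (fromReducedNormalisation (baseChange f E) ≫ pullback.snd f (specMap k E)) where
  isPurelyInseparable := .tower_bot k l E
  pow_mem x := by
    obtain ⟨c, hc⟩ := hE (algebraMap l E x)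
    refine ⟨c, (algebraMap l E).injective ?_⟩
    rw [← IsScalarTower.algebraMap_apply, hc, map_pow]
  isIntegral_baseChange := inferInstance
  comm := fromReducedNormalisation_fst_comp
  isNormalisation := isNormalisation_lift_fromReducedNormalisation hι
  isIntegral := inferInstance
  isAlgClosureIn := isAlgClosureIn_toFunctionField_fromReducedNormalisation hι h

end ElementalExtension

section RootField

variable {k : Type u} [Field k] {p : ℕ} [Fact p.Prime] [CharP k p]

lemma exists_pow_eq_algebraMap_rootField (c : k) :
    ∃ b : rootField k p, b ^ p = algebraMap k (rootField k p) c := by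
  obtain ⟨z, hz⟩ := IsAlgClosed.exists_pow_nat_eq (algebraMap k (AlgebraicClosure k) c)
    (Fact.out : p.Prime).pos
  exact ⟨⟨z, c, hz.symm⟩, Subtype.ext hz⟩

lemma pow_mem_range_rootField (x : rootField k p) :
    x ^ p ∈ (algebraMap k (rootField k p)).range :=
  let ⟨c, hc⟩ := x.2
  ⟨c, Subtype.ext hc⟩

variable {X : Scheme.{u}} [IsIntegral X] {f : X ⟶ Spec (.of k)}

theorem exists_isRootClosure (hk : IsAlgClosedInFunctionField f) :
    ∃ l : IntermediateField k (rootField k p), IsRootClosure p f l := by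
  let := (toFunctionField f).toAlgebra
  obtain ⟨l, hl, ⟨σ⟩⟩ := exists_isReduced_tensorProduct_and_nonempty_algHom (k := k) (p := p)
    X.functionField pow_mem_range_rootField
  have : IsReduced (baseChange f l) := (isReduced_baseChange_iff rfl).mpr hl
  have hint : IsIntegral (baseChange f l) := isIntegral_of_irreducibleSpace_of_isReduced _
  let : Algebra k (baseChange f l).functionField :=
    (toFunctionField (pullback.fst f (specMap k l) ≫ f)).toAlgebra
  obtain ⟨φ, κ, -, hκ, hsurj⟩ := exists_productMap_surjective (f := f) rfl
    (𝟙 (baseChange f l)) (Category.id_comp _) rfl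
  rw [Category.id_comp] at hκ
  let ι : rootField k p →ₐ[k] (baseChange f l).functionField :=
    (Algebra.TensorProduct.productMap φ κ).comp σ
  have hικ : ι.comp l.val = κ := Subsingleton.elim _ _
  have hl_pow (x : l) : x ^ p ∈ (algebraMap k l).range :=
    let ⟨c, hc⟩ := pow_mem_range_rootField (x : rootField k p)
    ⟨c, Subtype.ext hc⟩
  have hpow (y : (baseChange f l).functionField) : ∃ a, φ a = y ^ p := by
    obtain ⟨t, rfl⟩ := hsurj y
    obtain ⟨a, ha⟩ := exists_pow_eq_tmul_one hl_pow t
    exact ⟨a, by rw [← map_pow, ha, Algebra.TensorProduct.productMap_left_apply]⟩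
  refine ⟨l, hint, ι.toRingHom, hκ ▸ congrArg AlgHom.toRingHom hικ, ?_⟩
  rw [← isAlgClosureIn_comp_algebraMap_iff (k := k), ← toFunctionField_comp_specMap,
    ← pullback.condition]
  exact mem_range_iff_isAlgebraic_of_forall_pow_mem_range exists_pow_eq_algebraMap_rootField
    (fun a ha => (hk a).mpr ha) φ hpow ι

end RootField

section GeometricallyReduced

variable {k : Type u} [Field k] {p : ℕ} [Fact p.Prime] [CharP k p]
  {X : Scheme.{u}} [IsIntegral X] {f : X ⟶ Spec (.of k)} {E : Type u} [Field E] [Algebra k E]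

lemma eq_top_of_isReduced_baseChange [IsPurelyInseparable k E]
    (hE : ∀ x : E, x ^ p ∈ (algebraMap k E).range)
    [IsReduced (baseChange f E)] {l : IntermediateField k E} [IsIntegral (baseChange f l)]
    {ι : E →+* (baseChange f l).functionField}
    (hι : ι.comp (algebraMap l E) = toFunctionField (pullback.snd f (specMap k l))) : l = ⊤ := by
  let := (toFunctionField f).toAlgebra
  let : Algebra k (baseChange f l).functionField :=
    (toFunctionField (pullback.fst f (specMap k l) ≫ f)).toAlgebra
  obtain ⟨φ, κ, -, -, hsurj⟩ := exists_productMap_surjective (f := f) rfl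
    (𝟙 (baseChange f l)) (Category.id_comp _) rfl
  have hιk : ι.comp (algebraMap k E) = algebraMap k (baseChange f l).functionField := by
    rw [IsScalarTower.algebraMap_eq k l E, ← RingHom.comp_assoc, hι,
      ← toFunctionField_comp_specMap, ← pullback.condition]
    rfl
  let ιAlg : E →ₐ[k] (baseChange f l).functionField := ⟨ι, DFunLike.congr_fun hιk⟩
  have hικ : ιAlg.comp l.val = κ := Subsingleton.elim _ _
  have : _root_.IsReduced (X.functionField ⊗[k] E) := (isReduced_baseChange_iff rfl).mp ‹_›
  exact eq_top_of_productMap_surjective hE φ ιAlg (hικ ▸ hsurj)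

lemma geometricallyReduced_of_isReduced_baseChange
    (hE : ∀ c : k, ∃ b : E, b ^ p = algebraMap k E c) [IsReduced (baseChange f E)] :
    GeometricallyReduced f := by
  let := (toFunctionField f).toAlgebra
  have : _root_.IsReduced (X.functionField ⊗[k] E) := (isReduced_baseChange_iff rfl).mp ‹_›
  have : _root_.IsReduced (E ⊗[k] X.functionField) :=
    isReduced_of_injective _ (Algebra.TensorProduct.comm k E X.functionField).injective
  rw [geometricallyReduced_iff, geometrically_iff_of_commRing_of_isClosedUnderIsomorphisms]
  intro F _ _
  have : _root_.IsReduced (F ⊗[k] X.functionField) :=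
    isReduced_tensorProduct_of_forall_exists_pow_eq hE F
  exact (isReduced_baseChange_iff rfl).mpr
    (isReduced_of_injective _ (Algebra.TensorProduct.comm k X.functionField F).injective)

end GeometricallyReduced

end Elemental

theorem mainTheorem6_general {k : Type u} [Field k] {p : ℕ} [Fact p.Prime] [CharP k p]
    {X : Scheme.{u}} [IsIntegral X] {f : X ⟶ Spec (.of k)}
    (hk : Elemental.IsAlgClosedInFunctionField f) :
    (∃ l : IntermediateField k (Elemental.rootField k p), Elemental.IsRootClosure p f l) ∧
    (∀ l : IntermediateField k (Elemental.rootField k p), Elemental.IsRootClosure p f l →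
      Elemental.IsElementalExtension p (k := k) (l := l) (k' := Elemental.rootField k p) f
        (Elemental.fromReducedNormalisation (Elemental.baseChange f (Elemental.rootField k p)) ≫
          pullback.fst f (Elemental.specMap k (Elemental.rootField k p)))
        (Elemental.fromReducedNormalisation (Elemental.baseChange f (Elemental.rootField k p)) ≫
          pullback.snd f (Elemental.specMap k (Elemental.rootField k p)))) ∧
    (∀ l : IntermediateField k (Elemental.rootField k p), Elemental.IsRootClosure p f l →
      (GeometricallyReduced f ↔ l = ⊤)) := by
  refine ⟨Elemental.exists_isRootClosure hk, ?_, ?_⟩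
  · rintro l ⟨_, ι, hι, h⟩
    exact Elemental.isElementalExtension_of_isAlgClosureIn Elemental.pow_mem_range_rootField hι h
  · rintro l ⟨_, ι, hι, h⟩
    constructor
    · intro hf
      have : IsReduced (Elemental.baseChange f (Elemental.rootField k p)) :=
        pullback_of_geometrically hf.geometrically_isReduced _ _
      exact Elemental.eq_top_of_isReduced_baseChange Elemental.pow_mem_range_rootField hι
    · rintro rfl
      exact Elemental.geometricallyReduced_of_isReduced_baseChange (p := p)
        (E := (⊤ : IntermediateField k (Elemental.rootField k p))) fun c =>
          let ⟨b, hb⟩ := Elemental.exists_pow_eq_algebraMap_rootField c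
          ⟨⟨b, trivial⟩, Subtype.ext hb⟩

theorem mainTheorem6 (k : Type u) [Field k] (p : ℕ) [Fact p.Prime] [CharP k p]
    (X : Scheme.{u}) (f : X ⟶ Spec (.of k))
    [IsIntegral X] [LocallyOfFiniteType f] [QuasiCompact f] [IsSeparated f]
    (hk : Elemental.IsAlgClosedInFunctionField f) :
    (∃ l : IntermediateField k (Elemental.rootField k p), Elemental.IsRootClosure p f l) ∧
    (∀ l : IntermediateField k (Elemental.rootField k p), Elemental.IsRootClosure p f l →
      Elemental.IsElementalExtension p (k := k) (l := l) (k' := Elemental.rootField k p) f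
        (Elemental.fromReducedNormalisation (Elemental.baseChange f (Elemental.rootField k p)) ≫
          pullback.fst f (Elemental.specMap k (Elemental.rootField k p)))
        (Elemental.fromReducedNormalisation (Elemental.baseChange f (Elemental.rootField k p)) ≫
          pullback.snd f (Elemental.specMap k (Elemental.rootField k p)))) ∧
    (∀ l : IntermediateField k (Elemental.rootField k p), Elemental.IsRootClosure p f l →
      (GeometricallyReduced f ↔ l = ⊤)) :=
  mainTheorem6_general hk
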